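/- Let $N$ be a finite set of agents and $\Theta$ a set of atomic propositions; a \emph{coalition} is a subset of $N$. CLD-formulas are given by $$\varphi ::= p \mid \neg\varphi \mid \varphi\wedge\varphi \mid [H]\varphi \mid K_i\varphi \mid D_G\varphi \qquad (p\in\Theta,\ i\in N,\ H\subseteq N,\ \emptyset\neq G\subseteq N),$$ with $\varphi\to\psi$, $\varphi\leftrightarrow\psi$, $\bot$, $\top$ the usual abbreviations ($\varphi\to\psi$ is $\neg(\varphi\wedge\neg\psi)$, $\bot$ is any formula $\chi\wedge\neg\chi$, $\top$ is $\neg\bot$). The system $CLD$ has as axioms all instances of classical propositional tautologies and of (G1) $\neg[G]\bot$; (G2) $[G]\top$; (G3) $\neg[\emptyset]\neg\varphi\to[N]\varphi$; (G4) $[G](\varphi\wedge\psi)\to[G]\psi$; (G5) $[G_1]\varphi\wedge[G_2]\psi\to[G_1\cup G_2](\varphi\wedge\psi)$ if $G_1\cap G_2=\emptyset$; (K) $K_i(\varphi\to\psi)\to(K_i\varphi\to K_i\psi)$; (T) $K_i\varphi\to\varphi$; (4) $K_i\varphi\to K_iK_i\varphi$; (5) $\neg K_i\varphi\to K_i\neg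 K_i\varphi$; (DK) $D_G(\varphi\to\psi)\to(D_G\varphi\to D_G\psi)$; (DT) $D_G\varphi\to\varphi$; (D4) $D_G\varphi\to D_GD_G\varphi$; (D5) $\neg D_G\varphi\to D_G\neg D_G\varphi$; (D1) $K_i\varphi\leftrightarrow D_{\{i\}}\varphi$; (D2) $D_G\varphi\to D_H\varphi$ if $G\subseteq H$; and as rules: modus ponens; from $\varphi\leftrightarrow\psi$ infer $[G]\varphi\leftrightarrow[G]\psi$; from $\varphi$ infer $K_i\varphi$. An \emph{epistemic coalition model} $M=\langle S,E,(\sim_i)_{i\in N},V\rangle$ consists of a non-empty set $S$ of states, a set $V(s)\subseteq\Theta$ for each $s\in S$, an equivalence relation $\sim_i$ on $S$ for each $i\in N$, and for each $s\in S$ a truly playable effectivity function $E(s)$, that is, a map from coalitions $G$ to families $E(s)(G)\subseteq 2^S$ such that, for all coalitions $G,G_1,G_2$ and all $X,Y\subseteq S$: (E1) $\emptyset\notin E(s)(G)$; (E2) $S\in E(s)(G)$; (E3) if $S\setminus X\notin E(s)(\emptyset)$ then $X\in E(s)(N)$; (E4) if $X\subseteq Y$ and $X\in E(s)(G)$ then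 $Y\in E(s)(G)$; (E5) if $G_1\cap G_2=\emptyset$, $X\in E(s)(G_1)$ and $Y\in E(s)(G_2)$ then $X\cap Y\in E(s)(G_1\cup G_2)$; (E6) the family $E(s)(\emptyset)$ has an element that is minimal with respect to inclusion. Truth is defined by: $M,s\models p$ iff $p\in V(s)$; the usual clauses for $\neg$ and $\wedge$; $M,s\models[G]\varphi$ iff $\{t\in S: M,t\models\varphi\}\in E(s)(G)$; $M,s\models K_i\varphi$ iff $M,t\models\varphi$ for all $t$ with $s\sim_i t$; $M,s\models D_G\varphi$ iff $M,t\models\varphi$ for all $t$ with $s\sim_i t$ for every $i\in G$. A formula is \emph{valid} if it is true at every state of every epistemic coalition model. Then $CLD$ is sound and complete: for every CLD-formula $\varphi$, $\varphi$ is derivable in $CLD$ if and only if $\varphi$ is valid. -/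

import Mathlib

universe u v w

/-- Formulas of coalition logic with individual and distributed knowledge, over a set `N` of
agents and a set `P` of atomic propositions. A coalition is a set of agents;
distributed knowledge is available only for non-empty coalitions. -/
inductive CLDFormula (N : Type u) (P : Type v) : Type (max u v)
  | atom (p : P) : CLDFormula N P
  | neg (φ : CLDFormula N P) : CLDFormula N P
  | conj (φ ψ : CLDFormula N P) : CLDFormula N P
  | coal (G : Set N) (φ : CLDFormula N P) : CLDFormula N P
  | know (i : N) (φ : CLDFormula N P) : CLDFormula N P
  | dist (G : Set N) (hG : G.Nonempty) (φ : CLDFormula N P) : CLDFormula N P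

namespace CLDFormula

variable {N : Type u} {P : Type v}

/-- Derived implication. -/
def imp (φ ψ : CLDFormula N P) : CLDFormula N P := neg (conj φ (neg ψ))

/-- Derived biconditional. -/
def iff (φ ψ : CLDFormula N P) : CLDFormula N P := conj (imp φ ψ) (imp ψ φ)

/-- Falsum, as the contradiction `χ ∧ ¬ χ`. The grammar has no falsum of its own, so it is
an abbreviation; the axioms below that mention it are stated for every `χ`. -/
def bot (χ : CLDFormula N P) : CLDFormula N P := conj χ (neg χ)

/-- Verum, the negation of falsum. -/
def top (χ : CLDFormula N P) : CLDFormula N P := neg (bot χ)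

/-- `φ` is an instance of a classical propositional tautology: it is true under every assignment
of truth values to formulas that respects negation and conjunction (and is
otherwise arbitrary on atoms and on formulas whose main operator is a modality). -/
def IsTautology (φ : CLDFormula N P) : Prop :=
  ∀ val : CLDFormula N P → Prop,
    (∀ ψ, val (neg ψ) ↔ ¬ val ψ) →
    (∀ ψ χ, val (conj ψ χ) ↔ (val ψ ∧ val χ)) →
    val φ

/-- Derivability in the axiomatic system CLD. -/
inductive Derivable : CLDFormula N P → Prop
  | prop (φ : CLDFormula N P) : IsTautology φ → Derivable φ
  | g1 (G : Set N) (χ : CLDFormula N P) : Derivable (neg (coal G (bot χ)))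
  | g2 (G : Set N) (χ : CLDFormula N P) : Derivable (coal G (top χ))
  | g3 (φ : CLDFormula N P) :
      Derivable (imp (neg (coal ∅ (neg φ))) (coal Set.univ φ))
  | g4 (G : Set N) (φ ψ : CLDFormula N P) :
      Derivable (imp (coal G (conj φ ψ)) (coal G ψ))
  | g5 (G₁ G₂ : Set N) (φ ψ : CLDFormula N P) : G₁ ∩ G₂ = ∅ →
      Derivable (imp (conj (coal G₁ φ) (coal G₂ ψ)) (coal (G₁ ∪ G₂) (conj φ ψ)))
  | mp (φ ψ : CLDFormula N P) : Derivable φ → Derivable (imp φ ψ) → Derivable ψ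
  | rg (G : Set N) (φ ψ : CLDFormula N P) :
      Derivable (iff φ ψ) → Derivable (iff (coal G φ) (coal G ψ))
  | k (i : N) (φ ψ : CLDFormula N P) :
      Derivable (imp (know i (imp φ ψ)) (imp (know i φ) (know i ψ)))
  | t (i : N) (φ : CLDFormula N P) : Derivable (imp (know i φ) φ)
  | four (i : N) (φ : CLDFormula N P) : Derivable (imp (know i φ) (know i (know i φ)))
  | five (i : N) (φ : CLDFormula N P) :
      Derivable (imp (neg (know i φ)) (know i (neg (know i φ))))
  | rn (i : N) (φ : CLDFormula N P) : Derivable φ → Derivable (know i φ)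
  | dk (G : Set N) (hG : G.Nonempty) (φ ψ : CLDFormula N P) :
      Derivable (imp (dist G hG (imp φ ψ)) (imp (dist G hG φ) (dist G hG ψ)))
  | dt (G : Set N) (hG : G.Nonempty) (φ : CLDFormula N P) : Derivable (imp (dist G hG φ) φ)
  | d4 (G : Set N) (hG : G.Nonempty) (φ : CLDFormula N P) :
      Derivable (imp (dist G hG φ) (dist G hG (dist G hG φ)))
  | d5 (G : Set N) (hG : G.Nonempty) (φ : CLDFormula N P) :
      Derivable (imp (neg (dist G hG φ)) (dist G hG (neg (dist G hG φ))))
  | d1 (i : N) (φ : CLDFormula N P) :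
      Derivable (iff (know i φ) (dist {i} (Set.singleton_nonempty i) φ))
  | d2 (G H : Set N) (hG : G.Nonempty) (hH : H.Nonempty) (φ : CLDFormula N P) : G ⊆ H →
      Derivable (imp (dist G hG φ) (dist H hH φ))

end CLDFormula

/-- The non-monotonic core of the empty coalition: the minimal elements of `E ∅`. -/
def nonmonotonicCore {N : Type u} {S : Type w} (E : Set N → Set (Set S)) : Set (Set S) :=
  {X | X ∈ E ∅ ∧ ¬ ∃ Y, Y ∈ E ∅ ∧ Y ⊂ X}

/-- Truly playable effectivity functions over agents `N` and states `S`. -/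
structure TrulyPlayable {N : Type u} {S : Type w} (E : Set N → Set (Set S)) : Prop where
  liveness : ∀ G, ∅ ∉ E G
  safety : ∀ G, Set.univ ∈ E G
  maximality : ∀ X : Set S, Xᶜ ∉ E ∅ → X ∈ E Set.univ
  monotonicity : ∀ (G : Set N) (X Y : Set S), X ⊆ Y → X ∈ E G → Y ∈ E G
  superadditivity : ∀ (G₁ G₂ : Set N) (X Y : Set S), G₁ ∩ G₂ = ∅ →
    X ∈ E G₁ → Y ∈ E G₂ → X ∩ Y ∈ E (G₁ ∪ G₂)
  core_nonempty : (nonmonotonicCore E).Nonempty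

/-- Epistemic coalition models with state space `S`. -/
structure EpistemicCoalitionModel (N : Type u) (P : Type v) (S : Type w) where
  /-- There is at least one state. -/
  states_nonempty : Nonempty S
  /-- The effectivity function at each state. -/
  E : S → Set N → Set (Set S)
  truly_playable : ∀ s, TrulyPlayable (E s)
  /-- The epistemic accessibility relation of each agent. -/
  acc : N → S → S → Prop
  acc_equivalence : ∀ i, Equivalence (acc i)
  /-- The set of atomic propositions true at each state. -/
  V : S → Set P

/-- Truth of a formula at a state of a model. -/
def EpistemicCoalitionModel.Sat {N : Type u} {P : Type v} {S : Type w}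
    (M : EpistemicCoalitionModel N P S) : CLDFormula N P → S → Prop
  | .atom p, s => p ∈ M.V s
  | .neg φ, s => ¬ M.Sat φ s
  | .conj φ ψ, s => M.Sat φ s ∧ M.Sat ψ s
  | .coal G φ, s => {t | M.Sat φ t} ∈ M.E s G
  | .know i φ, s => ∀ t, M.acc i s t → M.Sat φ t
  | .dist G _ φ, s => ∀ t, (∀ i ∈ G, M.acc i s t) → M.Sat φ t

/-- Validity: truth at every state of every epistemic coalition model whose states form a type
in the universe `w`. -/
def CLDFormula.Valid {N : Type u} {P : Type v} (φ : CLDFormula N P) : Prop :=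
  ∀ (S : Type w) (M : EpistemicCoalitionModel N P S) (s : S), M.Sat φ s

/-! Soundness is an induction on derivations. For completeness, an underivable `φ` fails at some
world of the canonical model (`derivable_of_forall_world`), and worlds are filtered through the
finite set `closure φ`. There `D_G` is read by its own relation `Indist C G`, agreement on all `D_H`
formulas of the closure with `H ⊆ G`. These relations are antitone in `G`, but `Indist C G` need not
be the intersection of the relations of the members of `G`.

`exists_coalition_unfolding` repairs this without losing finiteness: each atom is replaced by copies
carrying a record, over the two-element field, of the moves made by each coalition. An agent can
change only the records of its own coalitions, so a step common to all of `G` is forced to be a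
`G`-step below.

Since the atoms are finite in number, every set of states is described by a formula `δ X`
(`World.exists_defining`), and `X` is put in `E(s)(G)` when `[G] δ X` holds at the world under `s`.
Axioms (G1)–(G5) give playability, and finiteness gives (E6). -/

namespace CLDFormula

variable {N : Type u} {P : Type v}

/-- A truth assignment to formulas which respects negation and conjunction. -/
structure IsValuation (val : CLDFormula N P → Prop) : Prop where
  neg : ∀ ψ, val (neg ψ) ↔ ¬ val ψ
  conj : ∀ ψ χ, val (conj ψ χ) ↔ (val ψ ∧ val χ)

namespace IsValuation

variable {val : CLDFormula N P → Prop}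

theorem imp (h : IsValuation val) (φ ψ : CLDFormula N P) :
    val (imp φ ψ) ↔ (val φ → val ψ) := by
  simp only [CLDFormula.imp, h.neg, h.conj]; tauto

theorem iff (h : IsValuation val) (φ ψ : CLDFormula N P) :
    val (iff φ ψ) ↔ (val φ ↔ val ψ) := by
  simp only [CLDFormula.iff, h.conj, h.imp]; tauto

theorem bot (h : IsValuation val) (χ : CLDFormula N P) : ¬ val (bot χ) := by
  simp only [CLDFormula.bot, h.neg, h.conj]; tauto

theorem top (h : IsValuation val) (χ : CLDFormula N P) : val (top χ) :=
  (h.neg _).2 (h.bot χ)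

end IsValuation

theorem isTautology_iff (φ : CLDFormula N P) :
    IsTautology φ ↔ ∀ val : CLDFormula N P → Prop, IsValuation val → val φ :=
  ⟨fun h val hv => h val hv.neg hv.conj, fun h val h₁ h₂ => h val ⟨h₁, h₂⟩⟩

/-! ### Soundness -/

theorem _root_.EpistemicCoalitionModel.isValuation_sat {S : Type w}
    (M : EpistemicCoalitionModel N P S) (s : S) : IsValuation fun φ => M.Sat φ s :=
  ⟨fun _ => Iff.rfl, fun _ _ => Iff.rfl⟩

theorem Derivable.sat {φ : CLDFormula N P} (h : Derivable φ) {S : Type w}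
    (M : EpistemicCoalitionModel N P S) (s : S) : M.Sat φ s := by
  have himp := fun s => (M.isValuation_sat s).imp
  have hiff := fun s => (M.isValuation_sat s).iff
  -- The rules for `[G]` and `K_i` need their premise at every state, so `s` varies while the model
  -- stays fixed.
  induction h generalizing s with
  | prop φ h => exact (isTautology_iff φ).1 h _ (M.isValuation_sat s)
  | g1 G χ =>
    have h : {t | M.Sat (CLDFormula.bot χ) t} = ∅ :=
      Set.eq_empty_of_forall_notMem fun t => (M.isValuation_sat t).bot χ
    change ¬ {t | M.Sat (CLDFormula.bot χ) t} ∈ M.E s G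
    rw [h]
    exact (M.truly_playable s).liveness G
  | g2 G χ =>
    have h : {t | M.Sat (CLDFormula.top χ) t} = Set.univ :=
      Set.eq_univ_of_forall fun t => (M.isValuation_sat t).top χ
    change {t | M.Sat (CLDFormula.top χ) t} ∈ M.E s G
    rw [h]
    exact (M.truly_playable s).safety G
  | g3 φ => exact (himp s _ _).2 fun h => (M.truly_playable s).maximality _ h
  | g4 G φ ψ =>
    exact (himp s _ _).2 fun h => (M.truly_playable s).monotonicity G _ _ (fun _ ht => ht.2) h
  | g5 G₁ G₂ φ ψ hG =>
    exact (himp s _ _).2 fun h => (M.truly_playable s).superadditivity G₁ G₂ _ _ hG h.1 h.2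
  | mp φ ψ _ _ ih₁ ih₂ => exact (himp s _ _).1 (ih₂ s) (ih₁ s)
  | rg G φ ψ _ ih =>
    refine (hiff s _ _).2 ?_
    have h : {t | M.Sat φ t} = {t | M.Sat ψ t} := Set.ext fun t => (hiff t _ _).1 (ih t)
    change {t | M.Sat φ t} ∈ M.E s G ↔ {t | M.Sat ψ t} ∈ M.E s G
    rw [h]
  | k i φ ψ =>
    exact (himp s _ _).2 fun h => (himp s _ _).2 fun h' t ht => (himp t _ _).1 (h t ht) (h' t ht)
  | t i φ => exact (himp s _ _).2 fun h => h s ((M.acc_equivalence i).refl s)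
  | four i φ =>
    exact (himp s _ _).2 fun h t ht r hr => h r ((M.acc_equivalence i).trans ht hr)
  | five i φ =>
    exact (himp s _ _).2 fun h t ht h' => h fun r hr =>
      h' r ((M.acc_equivalence i).trans ((M.acc_equivalence i).symm ht) hr)
  | rn i φ _ ih => exact fun t _ => ih t
  | dk G hG φ ψ =>
    exact (himp s _ _).2 fun h => (himp s _ _).2 fun h' t ht => (himp t _ _).1 (h t ht) (h' t ht)
  | dt G hG φ => exact (himp s _ _).2 fun h => h s fun i _ => (M.acc_equivalence i).refl s
  | d4 G hG φ =>
    exact (himp s _ _).2 fun h t ht r hr =>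
      h r fun i hi => (M.acc_equivalence i).trans (ht i hi) (hr i hi)
  | d5 G hG φ =>
    exact (himp s _ _).2 fun h t ht h' => h fun r hr => h' r fun i hi =>
      (M.acc_equivalence i).trans ((M.acc_equivalence i).symm (ht i hi)) (hr i hi)
  | d1 i φ =>
    exact (hiff s _ _).2 ⟨fun h t ht => h t (ht i rfl), fun h t ht => h t (by rintro j rfl; exact ht)⟩
  | d2 G H hG hH φ hGH => exact (himp s _ _).2 fun h t ht => h t fun i hi => ht i (hGH hi)

/-! ### Worlds -/

/-- A set of formulas containing all tautologies and closed under modus ponens is the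
intersection of the valuations that extend it. -/
theorem exists_isValuation_of_not_mem {T : CLDFormula N P → Prop}
    (taut : ∀ φ, IsTautology φ → T φ) (mp : ∀ φ ψ, T φ → T (imp φ ψ) → T ψ)
    {φ : CLDFormula N P} (hφ : ¬ T φ) :
    ∃ val, IsValuation val ∧ (∀ ψ, T ψ → val ψ) ∧ ¬ val φ := by
  classical
  -- Compactness, finite part: premises from `F` are discharged one at a time by modus ponens.
  have key : ∀ (F : Finset {ψ // T ψ}) (φ : CLDFormula N P),
      (∀ val, IsValuation val → (∀ ψ ∈ F, val ψ.1) → val φ) → T φ := by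
    intro F
    induction F using Finset.induction_on with
    | empty =>
      intro φ h
      exact taut φ ((isTautology_iff φ).2 fun val hv => h val hv (by simp))
    | insert a F _ ih =>
      intro φ h
      refine mp a.1 φ a.2 (ih _ fun val hv hF => (hv.imp _ _).2 fun ha => h val hv ?_)
      simpa [Finset.forall_mem_insert] using ⟨ha, fun x hx => hF ⟨x, hx⟩⟩
  have hex : ∀ F : Finset {ψ // T ψ}, ∃ val, IsValuation val ∧ (∀ ψ ∈ F, val ψ.1) ∧ ¬ val φ := by
    intro F
    by_contra! h
    exact hφ (key F φ h)
  choose val hval hF hnot using hex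
  -- Truth at `U`-almost every `F` respects the connectives because `U` is an ultrafilter. It
  -- contains `T`, because each member of `T` lies in all large enough `F`.
  let U : Ultrafilter (Finset {ψ // T ψ}) := Ultrafilter.of Filter.atTop
  refine ⟨fun ψ => ∀ᶠ F in U, val F ψ, ⟨fun ψ => ?_, fun ψ χ => ?_⟩, fun ψ hψ => ?_, ?_⟩
  · simp only [(hval _).neg]
    exact Ultrafilter.eventually_not
  · simp only [(hval _).conj]
    exact Filter.eventually_and
  · refine Ultrafilter.of_le (Filter.atTop) ?_
    filter_upwards [Filter.eventually_ge_atTop {⟨ψ, hψ⟩}] with F hle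
    exact hF F ⟨ψ, hψ⟩ (hle (Finset.mem_singleton_self _))
  · exact Ultrafilter.eventually_not.1 (Filter.Eventually.of_forall hnot)

variable (N P) in
/-- Worlds of the canonical model: the valuations at which all derivable formulas are true. -/
structure World where
  /-- The formulas true at the world. -/
  val : CLDFormula N P → Prop
  isValuation : IsValuation val
  derivable : ∀ φ, Derivable φ → val φ

theorem derivable_of_forall_world {φ : CLDFormula N P} (h : ∀ x : World N P, x.val φ) :
    Derivable φ := by
  by_contra hφ
  obtain ⟨val, hv, hd, hn⟩ := exists_isValuation_of_not_mem Derivable.prop Derivable.mp hφ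
  exact hn (h ⟨val, hv, hd⟩)

/-- The system has no necessitation rule for `D_G`; it follows from the one for `K_i` with any `i ∈
G`, through (D1) and (D2). -/
theorem Derivable.dist {φ : CLDFormula N P} (h : Derivable φ) (G : Set N) (hG : G.Nonempty) :
    Derivable (dist G hG φ) := by
  obtain ⟨i, hi⟩ := id hG
  refine derivable_of_forall_world fun x => ?_
  have h₁ := ((x.isValuation.iff _ _).1 (x.derivable _ (.d1 i φ))).1 (x.derivable _ (.rn i φ h))
  exact (x.isValuation.imp _ _).1
    (x.derivable _ (.d2 {i} G (Set.singleton_nonempty i) hG φ (by simpa using hi))) h₁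

namespace World

theorem of_imp (x : World N P) {φ ψ : CLDFormula N P} (h : Derivable (imp φ ψ)) (hφ : x.val φ) :
    x.val ψ :=
  (x.isValuation.imp _ _).1 (x.derivable _ h) hφ

theorem know_iff (x : World N P) (i : N) (φ : CLDFormula N P) :
    x.val (know i φ) ↔ x.val (dist {i} (Set.singleton_nonempty i) φ) :=
  (x.isValuation.iff _ _).1 (x.derivable _ (.d1 i φ))

/-- Thus `[G]` sees a formula only through the set of worlds where it holds, which is what lets a
defining formula `δ X` stand for the set `X`. -/
theorem coal_congr (x : World N P) (G : Set N) {φ ψ : CLDFormula N P}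
    (h : ∀ y : World N P, y.val φ ↔ y.val ψ) : x.val (coal G φ) ↔ x.val (coal G ψ) :=
  (x.isValuation.iff _ _).1 (x.derivable _ (.rg G φ ψ
    (derivable_of_forall_world fun y => (y.isValuation.iff _ _).2 (h y))))

/-- If `D_G ψ` fails at a world, some world agreeing with it on the knowledge of all
subcoalitions of `G` refutes `ψ`. -/
theorem exists_of_not_dist (x : World N P) {G : Set N} {hG : G.Nonempty} {ψ : CLDFormula N P}
    (h : ¬ x.val (dist G hG ψ)) :
    ∃ y : World N P, ¬ y.val ψ ∧ ∀ (H : Set N) (hH : H.Nonempty) (χ : CLDFormula N P), H ⊆ G →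
      (x.val (dist H hH χ) ↔ y.val (dist H hH χ)) := by
  -- `T` is what `G` knows at `x`. By (D4), (D5) and (D2) it already decides every `D_H χ` with `H ⊆
  -- G`, and in the same way as `x`.
  obtain ⟨val, hv, hT, hn⟩ := exists_isValuation_of_not_mem (T := fun χ => x.val (dist G hG χ))
    (fun φ hφ => x.derivable _ ((Derivable.prop φ hφ).dist G hG))
    (fun φ ψ h₁ h₂ => (x.isValuation.imp _ _).1 (x.of_imp (.dk G hG φ ψ) h₂) h₁) h
  refine ⟨⟨val, hv, fun φ hφ => hT φ (x.derivable _ (hφ.dist G hG))⟩, hn, ?_⟩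
  intro H hH χ hHG
  refine ⟨fun hx => hT _ (x.of_imp (.d2 H G hH hG _ hHG) (x.of_imp (.d4 H hH χ) hx)), ?_⟩
  intro hy
  by_contra hx
  exact (hv.neg _).1 (hT _ (x.of_imp (.d2 H G hH hG _ hHG)
    (x.of_imp (.d5 H hH χ) ((x.isValuation.neg _).2 hx)))) hy

/-- A set of worlds that depends only on the truth values of finitely many formulas is
defined by a formula. -/
theorem exists_defining [Nonempty (CLDFormula N P)] {C : Set (CLDFormula N P)} (hC : C.Finite)
    (A : World N P → Prop)
    (hA : ∀ x y : World N P, (∀ χ ∈ C, x.val χ ↔ y.val χ) → (A x ↔ A y)) :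
    ∃ δ : CLDFormula N P, ∀ x : World N P, x.val δ ↔ A x := by
  induction C, hC using Set.Finite.induction_on generalizing A with
  | empty =>
    obtain ⟨χ⟩ := ‹Nonempty (CLDFormula N P)›
    by_cases h : ∃ x, A x
    · obtain ⟨x₀, hx₀⟩ := h
      exact ⟨.top χ, fun x => iff_of_true (x.isValuation.top χ) ((hA x₀ x (by simp)).1 hx₀)⟩
    · push Not at h
      exact ⟨.bot χ, fun x => iff_of_false (x.isValuation.bot χ) (h x)⟩
  | @insert c C _ _ ih =>
    -- Saturating a part of `A` under agreement on the smaller `C` makes the induction hypothesis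
    -- applicable. The parts where `c` is true and where `c` is false are then glued by cases on
    -- `c`.
    have hB : ∀ Q : World N P → Prop, ∃ δ : CLDFormula N P, ∀ x : World N P,
        x.val δ ↔ ∃ y, Q y ∧ A y ∧ ∀ χ ∈ C, x.val χ ↔ y.val χ := by
      refine fun Q => ih _ fun x x' h => exists_congr fun y => ?_
      refine and_congr_right fun _ => and_congr_right fun _ => forall₂_congr fun χ hχ => ?_
      rw [h χ hχ]
    obtain ⟨δ₁, h₁⟩ := hB fun y => y.val c
    obtain ⟨δ₀, h₀⟩ := hB fun y => ¬ y.val c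
    refine ⟨.conj (.imp c δ₁) (.imp (.neg c) δ₀), fun x => ?_⟩
    rw [x.isValuation.conj, x.isValuation.imp, x.isValuation.imp, x.isValuation.neg, h₁, h₀]
    have hmem : ∀ y, (x.val c ↔ y.val c) → (∀ χ ∈ C, x.val χ ↔ y.val χ) → (A x ↔ A y) :=
      fun y hc hy => hA x y (by simpa [Set.forall_mem_insert] using ⟨hc, hy⟩)
    refine ⟨fun ⟨hp, hn⟩ => ?_, fun hx => ⟨fun hc => ⟨x, hc, hx, fun _ _ => Iff.rfl⟩,
      fun hc => ⟨x, hc, hx, fun _ _ => Iff.rfl⟩⟩⟩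
    by_cases hc : x.val c
    · obtain ⟨y, hy, hAy, h⟩ := hp hc
      exact (hmem y (iff_of_true hc hy) h).2 hAy
    · obtain ⟨y, hy, hAy, h⟩ := hn hc
      exact (hmem y (iff_of_false hc hy) h).2 hAy

end World

/-! ### Subformulas and the filtrated set of states -/

/-- The subformulas of a formula, and `D_{i} ψ` for each subformula `K_i ψ`. -/
def closure : CLDFormula N P → Set (CLDFormula N P)
  | .atom p => {.atom p}
  | .neg φ => insert (.neg φ) (closure φ)
  | .conj φ ψ => insert (.conj φ ψ) (closure φ ∪ closure ψ)
  | .coal G φ => insert (.coal G φ) (closure φ)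
  | .know i φ =>
    insert (.know i φ) (insert (.dist {i} (Set.singleton_nonempty i) φ) (closure φ))
  | .dist G hG φ => insert (.dist G hG φ) (closure φ)

theorem finite_closure (φ : CLDFormula N P) : (closure φ).Finite := by
  induction φ with
  | atom p => exact Set.finite_singleton _
  | neg φ ih => exact ih.insert _
  | conj φ ψ ih₁ ih₂ => exact (ih₁.union ih₂).insert _
  | coal G φ ih => exact ih.insert _
  | know i φ ih => exact (ih.insert _).insert _
  | dist G hG φ ih => exact ih.insert _

theorem mem_closure_self (φ : CLDFormula N P) : φ ∈ closure φ := by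
  cases φ <;> simp [closure]

/-- Agreement of worlds on a set of formulas. -/
def agreement (C : Set (CLDFormula N P)) : Setoid (World N P) where
  r x y := ∀ χ ∈ C, x.val χ ↔ y.val χ
  iseqv := ⟨fun _ _ _ => Iff.rfl, fun h χ hχ => (h χ hχ).symm,
    fun h h' χ hχ => (h χ hχ).trans (h' χ hχ)⟩

/-- Worlds up to agreement on a set of formulas. -/
abbrev Atom (C : Set (CLDFormula N P)) := Quotient (agreement C)

theorem finite_atom {C : Set (CLDFormula N P)} (hC : C.Finite) : Finite (Atom C) := by
  have := hC.to_subtype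
  refine Finite.of_injective
    (fun s : Atom C => fun c : C => s.out.val c.1) fun s t h => ?_
  rw [← s.out_eq, ← t.out_eq]
  exact Quotient.sound fun χ hχ => iff_of_eq (congrFun h ⟨χ, hχ⟩)

theorem out_mk_val {C : Set (CLDFormula N P)} (x : World N P) {χ : CLDFormula N P}
    (hχ : χ ∈ C) : (Quotient.mk (agreement C) x).out.val χ ↔ x.val χ :=
  Quotient.mk_out (s := agreement C) x χ hχ

/-- Two atoms agree on the distributed knowledge of all subcoalitions of `G`. -/
def Indist (C : Set (CLDFormula N P)) (G : Set N) (s t : Atom C) : Prop :=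
  ∀ (H : Set N) (hH : H.Nonempty) (χ : CLDFormula N P), H ⊆ G → dist H hH χ ∈ C →
    (s.out.val (dist H hH χ) ↔ t.out.val (dist H hH χ))

theorem indist_equivalence (C : Set (CLDFormula N P)) (G : Set N) :
    Equivalence (Indist C G) :=
  ⟨fun _ _ _ _ _ _ => Iff.rfl, fun h H hH χ h₁ h₂ => (h H hH χ h₁ h₂).symm,
    fun h h' H hH χ h₁ h₂ => (h H hH χ h₁ h₂).trans (h' H hH χ h₁ h₂)⟩

theorem Indist.mono {C : Set (CLDFormula N P)} {G G' : Set N} (hG : G ⊆ G') {s t : Atom C}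
    (h : Indist C G' s t) : Indist C G s t :=
  fun H hH χ h₁ h₂ => h H hH χ (h₁.trans hG) h₂

/-- This is the truth lemma for `D_G` with `Indist C G` as its relation: (DT) gives one direction,
the witness of `exists_of_not_dist` the other. -/
theorem dist_iff_forall_indist {C : Set (CLDFormula N P)} {G : Set N} {hG : G.Nonempty}
    {ψ : CLDFormula N P} (hD : dist G hG ψ ∈ C) (hψ : ψ ∈ C) (s : Atom C) :
    s.out.val (dist G hG ψ) ↔ ∀ t, Indist C G s t → t.out.val ψ := by
  refine ⟨fun h t ht => t.out.of_imp (.dt G hG ψ) ((ht G hG ψ le_rfl hD).1 h), fun h => ?_⟩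
  by_contra hn
  obtain ⟨y, hy, hxy⟩ := s.out.exists_of_not_dist hn
  refine hy ((out_mk_val y hψ).1 (h (Quotient.mk _ y) fun H hH χ hHG hC => ?_))
  rw [out_mk_val y hC]
  exact hxy H hH χ hHG

end CLDFormula

/-! ### Realizing the relations of coalitions as intersections -/

/-- A finite set with an equivalence relation for every coalition, antitone in the coalition,
is a retract of a finite set on which the relation of a coalition
is the intersection of the relations of its members. -/
theorem exists_coalition_unfolding {N : Type u} [Finite N] {S : Type v} [Finite S]
    (R : Set N → S → S → Prop) (hR : ∀ G, Equivalence (R G))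
    (hmono : ∀ G H, G ⊆ H → ∀ s t, R H s t → R G s t) :
    ∃ (T : Type w) (_ : Finite T) (f : T → S) (g : S → T) (acc : N → T → T → Prop),
      (∀ s, f (g s) = s) ∧ (∀ i, Equivalence (acc i)) ∧
      (∀ G : Set N, G.Nonempty → ∀ x y, (∀ i ∈ G, acc i x y) → R G (f x) (f y)) ∧
      (∀ (G : Set N) x t, R G (f x) t → ∃ y, f y = t ∧ ∀ i ∈ G, acc i x y) := by
  classical
  have := Fintype.ofFinite S
  have := Fintype.ofFinite (Set N)
  obtain ⟨k, ⟨e⟩⟩ := Finite.exists_equiv_fin (S × (Set N → S → ZMod 2))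
  -- `ULift` places the finite state space in an arbitrary universe, so validity in any single
  -- universe suffices.
  let e' : ULift.{w} (Fin k) ≃ S × (Set N → S → ZMod 2) := Equiv.ulift.trans e.symm
  -- In `(s, v)`, `s` is the current state and `v G` the net displacement due to moves of `G`. The
  -- current position minus all displacements is the starting point, which no move changes.
  let inv : S × (Set N → S → ZMod 2) → S → ZMod 2 := fun x a =>
    (Pi.single x.1 1 : S → ZMod 2) a - ∑ G, x.2 G a
  -- The last clause says that `v G` changes only by vectors with zero sum on each `R G`-class, as
  -- displacements along `R G` do.
  let acc : N → S × (Set N → S → ZMod 2) → S × (Set N → S → ZMod 2) → Prop := fun i x y =>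
    (∀ G, i ∉ G → x.2 G = y.2 G) ∧ (∀ a, inv x a = inv y a) ∧
      ∀ G, ∀ h : S → ZMod 2, (∀ a b, R G a b → h a = h b) →
        ∑ a, h a * x.2 G a = ∑ a, h a * y.2 G a
  refine ⟨ULift.{w} (Fin k), inferInstance, fun x => (e' x).1, fun s => e'.symm (s, 0),
    fun i x y => acc i (e' x) (e' y), by simp, fun i => ⟨?_, ?_, ?_⟩, ?_, ?_⟩
  · exact fun x => ⟨fun _ _ => rfl, fun _ => rfl, fun _ _ _ => rfl⟩
  · exact fun h => ⟨fun G hi => (h.1 G hi).symm, fun a => (h.2.1 a).symm,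
      fun G r hr => (h.2.2 G r hr).symm⟩
  · exact fun h h' => ⟨fun G hi => (h.1 G hi).trans (h'.1 G hi),
      fun a => (h.2.1 a).trans (h'.2.1 a), fun G r hr => (h.2.2 G r hr).trans (h'.2.2 G r hr)⟩
  · intro H ⟨i₀, hi₀⟩ x' y'
    beta_reduce
    obtain ⟨s, v⟩ := e' x'
    obtain ⟨t, u⟩ := e' y'
    intro hxy
    -- Pair everything with the indicator of the `R H`-class of `s`. If `H ⊆ G`, it is `R
    -- G`-invariant, so its pairing with `v G` is preserved; otherwise a member of `H` outside `G`
    -- fixes `v G` altogether. Equality of `inv` then leaves `h s = h t`.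
    let h : S → ZMod 2 := fun a => if R H s a then 1 else 0
    have hinv : ∀ a b, R H a b → h a = h b := fun a b hab => by
      have : R H s a ↔ R H s b :=
        ⟨fun q => (hR H).trans q hab, fun q => (hR H).trans q ((hR H).symm hab)⟩
      simp only [h, this]
    have hsum : ∀ G, ∑ a, h a * v G a = ∑ a, h a * u G a := by
      intro G
      by_cases hG : H ⊆ G
      · exact (hxy i₀ hi₀).2.2 G h fun a b hab => hinv a b (hmono H G hG a b hab)
      · obtain ⟨i, hi, hiG⟩ := Set.not_subset.1 hG
        have := (hxy i hi).1 G hiG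
        simp only at this
        rw [this]
    have hval : ∀ (r : S) (z : Set N → S → ZMod 2),
        ∑ a, h a * inv (r, z) a = h r - ∑ G, ∑ a, h a * z G a := by
      intro r z
      simp only [inv, mul_sub, Finset.sum_sub_distrib, Finset.mul_sum]
      rw [Finset.sum_comm]
      simp [Pi.single_apply]
    have h₁ : h s = h t := by
      have h₂ : ∑ a, h a * inv (s, v) a = ∑ a, h a * inv (t, u) a :=
        Finset.sum_congr rfl fun a _ => by rw [(hxy i₀ hi₀).2.1 a]
      rw [hval, hval, Finset.sum_congr rfl fun G _ => hsum G] at h₂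
      exact sub_left_inj.1 h₂
    by_contra hn
    simp only at hn
    simp [h, (hR H).refl s, hn] at h₁
  · intro H x' t
    beta_reduce
    obtain ⟨s, v⟩ := e' x'
    intro hst
    -- The move from `s` to `t` is charged to `H` alone.
    refine ⟨e'.symm (t, v + Pi.single H (Pi.single t 1 - Pi.single s 1)), by simp, fun i hi => ?_⟩
    simp only [Equiv.apply_symm_apply]
    refine ⟨fun G hG => ?_, fun a => ?_, fun G h hinv => ?_⟩
    · have : G ≠ H := by rintro rfl; exact hG hi
      simp [this]
    · have : ∑ G : Set N, (Pi.single H (Pi.single t 1 - Pi.single s 1) : Set N → S → ZMod 2) G a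
          = (Pi.single t 1 : S → ZMod 2) a - (Pi.single s 1 : S → ZMod 2) a := by
        rw [Finset.sum_eq_single H]
        · simp
        · intro G _ hG
          simp [hG]
        · simp
      simp only [inv, Pi.add_apply, Finset.sum_add_distrib, this]
      ring
    · by_cases hG : G = H
      · subst hG
        simp [mul_add, mul_sub, Finset.sum_add_distrib, Finset.sum_sub_distrib, Pi.single_apply,
          hinv s t hst]
      · simp [hG]

/-! ### Completeness -/

/-- On a finite set of states the empty coalition always has a minimal choice. -/
theorem nonmonotonicCore_nonempty {N : Type u} {S : Type w} [Finite S] {E : Set N → Set (Set S)}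
    (h : (E ∅).Nonempty) : (nonmonotonicCore E).Nonempty := by
  obtain ⟨X, hX⟩ := (Set.toFinite (E ∅)).exists_minimal h
  exact ⟨X, hX.1, fun ⟨Y, hY, hYX⟩ => hYX.2 (hX.2 hY hYX.1)⟩

namespace CLDFormula

variable {N : Type u} {P : Type v}

/-- The effectivity function determined by the formulas `[G] δ X` true at a world, where `δ X`
defines the set of worlds lying over `X`. -/
theorem World.trulyPlayable (x : World N P) {S : Type w} [Finite S] (q : World N P → S)
    (δ : Set S → CLDFormula N P) (hδ : ∀ X (y : World N P), y.val (δ X) ↔ q y ∈ X) :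
    TrulyPlayable fun G : Set N => {X : Set S | x.val (coal G (δ X))} := by
  -- Here and below `δ ∅` merely fills the place of the arbitrary `χ` in falsum and verum.
  have safety : ∀ G, x.val (coal G (δ Set.univ)) := fun G =>
    (x.coal_congr G fun y => iff_of_true (y.isValuation.top _) ((hδ _ y).2 (Set.mem_univ _))).1
      (x.derivable _ (.g2 G (δ ∅)))
  refine ⟨fun G h => ?_, safety, fun X h => ?_, fun G X Y hXY h => ?_,
    fun G₁ G₂ X Y hG h₁ h₂ => ?_, nonmonotonicCore_nonempty ⟨_, safety ∅⟩⟩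
  · refine (x.isValuation.neg _).1 (x.derivable _ (.g1 G (δ ∅))) ((x.coal_congr G fun y => ?_).1 h)
    exact iff_of_false (by simp [hδ]) (y.isValuation.bot _)
  · refine x.of_imp (.g3 (δ X)) ((x.isValuation.neg _).2 fun h' => h ?_)
    exact (x.coal_congr ∅ fun y => by rw [y.isValuation.neg, hδ, hδ]; rfl).1 h'
  · refine x.of_imp (.g4 G (δ X) (δ Y)) ((x.coal_congr G fun y => ?_).1 h)
    rw [y.isValuation.conj, hδ, hδ]
    exact ⟨fun hy => ⟨hy, hXY hy⟩, And.left⟩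
  · refine (x.coal_congr _ fun y => ?_).1
      (x.of_imp (.g5 G₁ G₂ (δ X) (δ Y) hG) ((x.isValuation.conj _ _).2 ⟨h₁, h₂⟩))
    rw [y.isValuation.conj, hδ, hδ, hδ]
    rfl

theorem exists_countermodel [Finite N] {φ : CLDFormula N P} (hφ : ¬ Derivable φ) :
    ∃ (T : Type w) (M : EpistemicCoalitionModel N P T) (s : T), ¬ M.Sat φ s := by
  obtain ⟨x₀, hx₀⟩ : ∃ x : World N P, ¬ x.val φ := by
    by_contra! h
    exact hφ (derivable_of_forall_world h)
  let C := closure φ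
  have := finite_atom (finite_closure φ)
  have : Nonempty (CLDFormula N P) := ⟨φ⟩
  obtain ⟨T, _, f, g, acc, hfg, hacc, hforth, hback⟩ :=
    exists_coalition_unfolding.{u, max u v, w} (Indist C) (indist_equivalence C)
      fun _ _ hGH _ _ h => h.mono hGH
  -- Each world is placed over its lift by `g`, so points of `T` outside the range of `g` do not
  -- affect effectivity.
  have hdef : ∀ Y : Set T, ∃ δ : CLDFormula N P, ∀ y : World N P,
      y.val δ ↔ g (Quotient.mk (agreement C) y) ∈ Y := fun Y =>
    World.exists_defining (finite_closure φ) _ fun x y h => by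
      rw [show Quotient.mk (agreement C) x = Quotient.mk (agreement C) y from Quotient.sound h]
  choose δ hδ using hdef
  let M : EpistemicCoalitionModel N P T :=
    { states_nonempty := ⟨g (Quotient.mk _ x₀)⟩
      -- `[G] δ X` need not lie in `C`, so this may depend on the chosen representative of the atom.
      -- That is harmless: truth is always compared at that same representative.
      E := fun s G => {X | (f s).out.val (coal G (δ X))}
      truly_playable := fun s => (f s).out.trulyPlayable _ δ hδ
      acc := acc
      acc_equivalence := hacc
      V := fun s => {p | (f s).out.val (.atom p)} }
  have hdist : ∀ (G : Set N) (hG : G.Nonempty) (ψ : CLDFormula N P), dist G hG ψ ∈ C → ψ ∈ C →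
      (∀ s, M.Sat ψ s ↔ (f s).out.val ψ) →
      ∀ s, (∀ t, (∀ i ∈ G, acc i s t) → M.Sat ψ t) ↔ (f s).out.val (dist G hG ψ) := by
    intro G hG ψ hD hψ ih s
    rw [dist_iff_forall_indist hD hψ]
    refine ⟨fun h t ht => ?_, fun h t ht => (ih t).2 (h _ (hforth G hG s t ht))⟩
    obtain ⟨y, rfl, hy⟩ := hback G s t ht
    exact (ih y).1 (h y hy)
  have truth : ∀ ψ : CLDFormula N P, closure ψ ⊆ C → ∀ s, M.Sat ψ s ↔ (f s).out.val ψ := by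
    intro ψ
    induction ψ with
    | atom p => exact fun _ _ => Iff.rfl
    | neg ψ ih =>
      intro h s
      rw [(f s).out.isValuation.neg, ← ih ((Set.subset_insert _ _).trans h) s]
      rfl
    | conj ψ χ ih₁ ih₂ =>
      intro h s
      have h' := (Set.subset_insert _ _).trans h
      rw [(f s).out.isValuation.conj, ← ih₁ (Set.subset_union_left.trans h') s,
        ← ih₂ (Set.subset_union_right.trans h') s]
      rfl
    | coal G ψ ih =>
      intro h s
      have h' := (Set.subset_insert _ _).trans h
      -- The formula defining the truth set of `ψ` agrees with `ψ` at every world `y`: the lift of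
      -- `y` lies over the atom of `y`, and `ψ ∈ C`.
      refine (f s).out.coal_congr G fun y => ?_
      rw [hδ]
      change M.Sat ψ _ ↔ _
      rw [ih h', hfg]
      exact out_mk_val y (h' (mem_closure_self ψ))
    | know i ψ ih =>
      intro h s
      have h₁ := (Set.subset_insert _ _).trans h
      have h₂ := (Set.subset_insert _ _).trans h₁
      -- `K_i` is handled as `D_{i}`, which is why `closure` contains that formula too.
      rw [World.know_iff, ← hdist {i} (Set.singleton_nonempty i) ψ (h₁ (Set.mem_insert _ _))
        (h₂ (mem_closure_self ψ)) (ih h₂) s]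
      simp only [Set.mem_singleton_iff, forall_eq]
      rfl
    | dist G hG ψ ih =>
      intro h s
      have h' := (Set.subset_insert _ _).trans h
      exact hdist G hG ψ (h (Set.mem_insert _ _)) (h' (mem_closure_self ψ)) (ih h') s
  refine ⟨T, M, g (Quotient.mk _ x₀), ?_⟩
  rw [truth φ le_rfl, hfg]
  exact fun h => hx₀ ((out_mk_val x₀ (mem_closure_self φ)).1 h)

end CLDFormula

theorem mainTheorem3 {N : Type u} [Finite N] {P : Type v} (φ : CLDFormula N P) :
    φ.Derivable ↔ CLDFormula.Valid.{u, v, w} φ := by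
  refine ⟨fun h S M s => h.sat M s, fun h => ?_⟩
  by_contra hφ
  obtain ⟨T, M, s, hs⟩ := CLDFormula.exists_countermodel.{u, v, w} hφ
  exact hs (h T M s)
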